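/- Let $\mathcal X\subseteq\mathbb R^d$ be Lebesgue measurable, equipped with the $\sigma$-algebra of its Lebesgue-measurable subsets and Lebesgue measure. Let $\pi$ be a probability density on $\mathcal X$ (the same letter denotes the corresponding distribution), let $\hat\pi:\mathcal X\to[0,\infty)$ be measurable (an approximation to $\pi$), and let $q$ be any proposal density: $q\ge 0$ is measurable on $\mathcal X\times\mathcal X$ and $\int_{\mathcal X} q(x,y)\,dy=1$ for every $x$. For an acceptance probability $\alpha$ let $$P_\alpha(x,dy)=q(x,y)\,\alpha(x,y)\,dy+\Big[1-\int_{\mathcal X} q(x,z)\,\alpha(x,z)\,dz\Big]\delta_x(dy).$$ The Metropolis–Hastings kernel $P_{MH}$ is $P_\alpha$ with $$\alpha(x,y)=1\wedge\frac{\pi(y)q(y,x)}{\pi(x)q(x,y)},$$ and the delayed-acceptance kernel $P_{DA}$ is $P_\alpha$ with $$\alpha(x,y)=\Big[1\wedge\frac{\hat\pi(y)q(y,x)}{\hat\pi(x)q(x,y)}\Big]\Big[1\wedge\frac{\pi(y)/\hat\pi(y)}{\pi(x)/\hat\pi(x)}\Big]$$ (quotients with zero denominator are read as $0$). A Markov kernel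 $P$ with stationary distribution $\pi$ is called variance bounding if for every $h\in L^2(\pi)$ the asymptotic variance $$\lim_{n\to\infty} n\,\mathrm{Var}\Big[\frac1n\sum_{i=1}^n h(X_i)\Big]$$ exists and is finite, where $(X_i)_{i\ge1}$ is the Markov chain with kernel $P$ and $X_1\sim\pi$. Suppose that there exist $\gamma_{lo}>0$ and $\gamma_{hi}<\infty$ such that $\gamma_{lo}\le\hat\pi(x)/\pi(x)\le\gamma_{hi}$ for every $x\in\mathcal X$ with $\pi(x)>0$. If $P_{MH}$ is variance bounding, then so is $P_{DA}$. -/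

import Mathlib

open MeasureTheory ProbabilityTheory Filter Topology

namespace DelayedAcceptance

/-! ### The state space -/

/-- The state space `𝒳 ⊆ ℝ^d`, as a type of its own (so that it can carry the Lebesgue
`σ`-algebra rather than the Borel one). -/
def StateSpace {d : ℕ} (X : Set (EuclideanSpace ℝ (Fin d))) : Type := ↥X

/-- The inclusion of `𝒳` into `ℝ^d`, where `ℝ^d` carries the `σ`-algebra of all Lebesgue measurable
(i.e. null measurable) sets. -/
def StateSpace.incl {d : ℕ} (X : Set (EuclideanSpace ℝ (Fin d))) :
    StateSpace X → NullMeasurableSpace (EuclideanSpace ℝ (Fin d)) volume :=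
  fun x => Subtype.val (p := fun y => y ∈ X) x

/-- `𝒳` carries the trace of the Lebesgue `σ`-algebra of `ℝ^d` (for Lebesgue measurable `𝒳`: all
Lebesgue measurable subsets of `𝒳`) and the restriction of Lebesgue measure. -/
noncomputable instance {d : ℕ} (X : Set (EuclideanSpace ℝ (Fin d))) :
    MeasureSpace (StateSpace X) where
  toMeasurableSpace := MeasurableSpace.comap (StateSpace.incl X) inferInstance
  volume := @Measure.comap _ _ (MeasurableSpace.comap (StateSpace.incl X) inferInstance) _
    (StateSpace.incl X) (Measure.completion volume)

theorem StateSpace.measurable_incl {d : ℕ} (X : Set (EuclideanSpace ℝ (Fin d))) :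
    Measurable (StateSpace.incl X) := comap_measurable _

theorem sigmaFinite_comap {α β : Type*} [MeasurableSpace α] [MeasurableSpace β] {f : α → β}
    (hf : Measurable f) (ν : Measure β) [SigmaFinite ν] : SigmaFinite (ν.comap f) := by
  refine ⟨⟨⟨fun n => f ⁻¹' spanningSets ν n, fun _ => trivial, fun n => ?_, ?_⟩⟩⟩
  · refine lt_of_le_of_lt (Measure.comap_apply_le f ν
      (hf (measurableSet_spanningSets ν n)).nullMeasurableSet) ?_
    exact lt_of_le_of_lt (measure_mono (Set.image_preimage_subset _ _))
      (measure_spanningSets_lt_top ν n)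
  · rw [← Set.preimage_iUnion, iUnion_spanningSets, Set.preimage_univ]

theorem sigmaFinite_completion {α : Type*} [MeasurableSpace α] (μ : Measure α) [SigmaFinite μ] :
    SigmaFinite μ.completion := by
  have h1 : ∀ n, μ (spanningSets μ n) < ⊤ := measure_spanningSets_lt_top μ
  have h2 : (⋃ n, spanningSets μ n) = Set.univ := iUnion_spanningSets μ
  generalize spanningSets μ = T at h1 h2
  exact ⟨⟨⟨T, fun _ => trivial, h1, h2⟩⟩⟩

instance {d : ℕ} (X : Set (EuclideanSpace ℝ (Fin d))) :
    SigmaFinite (volume : Measure (StateSpace X)) :=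
  have := sigmaFinite_completion (volume : Measure (EuclideanSpace ℝ (Fin d)))
  sigmaFinite_comap (StateSpace.measurable_incl X) _

/-! ### Densities, proposals and propose-accept-reject kernels -/

/-- A density, not necessarily normalised: a measurable function with values in `[0, ∞)`. -/
structure Density (S : Type*) [MeasurableSpace S] where
  toFun : S → ℝ
  measurable : Measurable toFun
  nonneg : ∀ x, 0 ≤ toFun x

instance (S : Type*) [MeasurableSpace S] : CoeFun (Density S) (fun _ => S → ℝ) := ⟨Density.toFun⟩

/-- The distribution with a given density. -/
noncomputable def Density.toMeasure {S : Type*} [MeasureSpace S] (π : Density S) : Measure S :=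
  (volume : Measure S).withDensity (fun x => ENNReal.ofReal (π x))

/-- A proposal density: `q x` is a probability density for each `x`, measurable in `(x, y)`. -/
structure Proposal (S : Type*) [MeasureSpace S] where
  toFun : S → S → ℝ
  measurable : Measurable (Function.uncurry toFun)
  nonneg : ∀ x y, 0 ≤ toFun x y
  integral_eq_one : ∀ x, ∫ y, toFun x y = 1

instance (S : Type*) [MeasureSpace S] : CoeFun (Proposal S) (fun _ => S → S → ℝ) :=
  ⟨Proposal.toFun⟩

/-- An acceptance probability: a measurable function of `(x, y)` with values in `[0, 1]`. -/
structure Acceptance (S : Type*) [MeasurableSpace S] where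
  toFun : S → S → ℝ
  measurable : Measurable (Function.uncurry toFun)
  nonneg : ∀ x y, 0 ≤ toFun x y
  le_one : ∀ x y, toFun x y ≤ 1

instance (S : Type*) [MeasurableSpace S] : CoeFun (Acceptance S) (fun _ => S → S → ℝ) :=
  ⟨Acceptance.toFun⟩

/-- The propose-accept-reject kernel
`P(x, dy) = q(x, y) α(x, y) dy + [1 - ∫ q(x, y) α(x, y) dy] δ_x(dy)`. -/
noncomputable def kernel {S : Type*} [MeasureSpace S] [SFinite (volume : Measure S)]
    (q : Proposal S) (α : Acceptance S) : Kernel S S where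
  toFun x := (volume : Measure S).withDensity (fun y => ENNReal.ofReal (q x y * α x y))
    + ENNReal.ofReal (1 - ∫ y, q x y * α x y) • Measure.dirac x
  measurable' := by
    have h1 : Measurable (Function.uncurry fun x y => q x y * α x y) :=
      q.measurable.mul α.measurable
    refine Measure.measurable_of_measurable_coe _ fun A hA => ?_
    simp only [Measure.add_apply, Measure.smul_apply, withDensity_apply _ hA,
      Measure.dirac_apply' _ hA, smul_eq_mul]
    refine Measurable.add ?_ (Measurable.mul ?_ ?_)
    · exact h1.ennreal_ofReal.lintegral_prod_right'
    · exact (measurable_const.sub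
        h1.stronglyMeasurable.integral_prod_right.measurable).ennreal_ofReal
    · exact measurable_one.indicator hA

instance {S : Type*} [MeasureSpace S] [SFinite (volume : Measure S)]
    (q : Proposal S) (α : Acceptance S) : IsMarkovKernel (kernel q α) := by
  refine ⟨fun x => ⟨?_⟩⟩
  have hqi : Integrable (fun y => q x y) := by
    by_contra h
    have := q.integral_eq_one x
    rw [integral_undef h] at this
    exact zero_ne_one this
  have hm : Measurable (fun y => q x y * α x y) :=
    (q.measurable.mul α.measurable).comp measurable_prodMk_left
  have h0 : ∀ y, 0 ≤ q x y * α x y := fun y => mul_nonneg (q.nonneg x y) (α.nonneg x y)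
  have hle : ∀ y, q x y * α x y ≤ q x y := fun y =>
    mul_le_of_le_one_right (q.nonneg x y) (α.le_one x y)
  have hi : Integrable (fun y => q x y * α x y) :=
    hqi.mono' hm.aestronglyMeasurable
      (Eventually.of_forall fun y => by rw [Real.norm_of_nonneg (h0 y)]; exact hle y)
  have hI : ∫ y, q x y * α x y ≤ 1 := by
    rw [← q.integral_eq_one x]
    exact integral_mono hi hqi hle
  have hI0 : 0 ≤ ∫ y, q x y * α x y := integral_nonneg h0
  change ((volume : Measure S).withDensity (fun y => ENNReal.ofReal (q x y * α x y))
    + ENNReal.ofReal (1 - ∫ y, q x y * α x y) • Measure.dirac x) Set.univ = 1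
  rw [Measure.add_apply, Measure.smul_apply, withDensity_apply _ MeasurableSet.univ,
    Measure.restrict_univ, ← ofReal_integral_eq_lintegral_ofReal hi (Eventually.of_forall h0),
    measure_univ, smul_eq_mul, mul_one, ← ENNReal.ofReal_add hI0 (sub_nonneg.2 hI)]
  simp

/-! ### Metropolis-Hastings and delayed acceptance

Quotients with a vanishing denominator are `0` here. Such a convention only concerns moves that are
proposed with density zero, and points `x` with `π x = 0` (a null set of the target) or with
`πhat x = 0`. -/

/-- `r_MH(x, y) = π(y) q(y, x) / (π(x) q(x, y))`. -/
noncomputable def ratioMH {S : Type*} [MeasureSpace S] (π : Density S) (q : Proposal S)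
    (x y : S) : ℝ :=
  (π y * q y x) / (π x * q x y)

/-- `r_2(x, y) = (π(y) / πhat(y)) / (π(x) / πhat(x))`, the ratio of the correction stage. -/
noncomputable def ratioCorrection {S : Type*} [MeasureSpace S] (π πhat : Density S)
    (x y : S) : ℝ :=
  (π y / πhat y) / (π x / πhat x)

theorem Proposal.measurable_swap {S : Type*} [MeasureSpace S] (q : Proposal S) :
    Measurable (fun p : S × S => q p.2 p.1) := q.measurable.comp _root_.measurable_swap

theorem measurable_ratioMH {S : Type*} [MeasureSpace S] (π : Density S) (q : Proposal S) :
    Measurable (fun p : S × S => ratioMH π q p.1 p.2) :=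
  ((π.measurable.comp measurable_snd).mul q.measurable_swap).div
    ((π.measurable.comp measurable_fst).mul q.measurable)

theorem measurable_ratioCorrection {S : Type*} [MeasureSpace S] (π πhat : Density S) :
    Measurable (fun p : S × S => ratioCorrection π πhat p.1 p.2) :=
  ((π.measurable.comp measurable_snd).div (πhat.measurable.comp measurable_snd)).div
    ((π.measurable.comp measurable_fst).div (πhat.measurable.comp measurable_fst))

theorem ratioMH_nonneg {S : Type*} [MeasureSpace S] (π : Density S) (q : Proposal S) (x y : S) :
    0 ≤ ratioMH π q x y :=
  div_nonneg (mul_nonneg (π.nonneg y) (q.nonneg y x)) (mul_nonneg (π.nonneg x) (q.nonneg x y))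

theorem ratioCorrection_nonneg {S : Type*} [MeasureSpace S] (π πhat : Density S) (x y : S) :
    0 ≤ ratioCorrection π πhat x y :=
  div_nonneg (div_nonneg (π.nonneg y) (πhat.nonneg y)) (div_nonneg (π.nonneg x) (πhat.nonneg x))

/-- `α_MH(x, y) = 1 ∧ r_MH(x, y)`. -/
noncomputable def acceptMH {S : Type*} [MeasureSpace S] (π : Density S) (q : Proposal S) :
    Acceptance S where
  toFun x y := min 1 (ratioMH π q x y)
  measurable := measurable_const.min (measurable_ratioMH π q)
  nonneg x y := le_min zero_le_one (ratioMH_nonneg π q x y)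
  le_one _ _ := min_le_left _ _

/-- `α_DA(x, y) = [1 ∧ r_1(x, y)] [1 ∧ r_2(x, y)]`, where the ratio `r_1` of the screening stage is
the Metropolis-Hastings ratio with `πhat` in place of `π`. -/
noncomputable def acceptDA {S : Type*} [MeasureSpace S] (π πhat : Density S) (q : Proposal S) :
    Acceptance S where
  toFun x y := min 1 (ratioMH πhat q x y) * min 1 (ratioCorrection π πhat x y)
  measurable := (measurable_const.min (measurable_ratioMH πhat q)).mul
    (measurable_const.min (measurable_ratioCorrection π πhat))
  nonneg x y := mul_nonneg (le_min zero_le_one (ratioMH_nonneg πhat q x y))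
    (le_min zero_le_one (ratioCorrection_nonneg π πhat x y))
  le_one x y := mul_le_one₀ (min_le_left _ _)
    (le_min zero_le_one (ratioCorrection_nonneg π πhat x y)) (min_le_left _ _)

/-- The Metropolis-Hastings kernel with target density `π` and proposal `q`. -/
noncomputable def kernelMH {S : Type*} [MeasureSpace S] [SFinite (volume : Measure S)]
    (π : Density S) (q : Proposal S) : Kernel S S :=
  kernel q (acceptMH π q)

/-- The delayed-acceptance kernel with target density `π`, approximation `πhat` and
proposal `q`. -/
noncomputable def kernelDA {S : Type*} [MeasureSpace S] [SFinite (volume : Measure S)]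
    (π πhat : Density S) (q : Proposal S) : Kernel S S :=
  kernel q (acceptDA π πhat q)

instance {S : Type*} [MeasureSpace S] [SFinite (volume : Measure S)]
    (π : Density S) (q : Proposal S) : IsMarkovKernel (kernelMH π q) :=
  inferInstanceAs (IsMarkovKernel (kernel q (acceptMH π q)))

instance {S : Type*} [MeasureSpace S] [SFinite (volume : Measure S)]
    (π πhat : Density S) (q : Proposal S) : IsMarkovKernel (kernelDA π πhat q) :=
  inferInstanceAs (IsMarkovKernel (kernel q (acceptDA π πhat q)))

/-! ### Asymptotic variance and variance bounding -/

/-- The law on `ℕ → S` of the homogeneous Markov chain with initial distribution `μ` and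
transition kernel `P`. -/
noncomputable def chainLaw {S : Type*} [MeasurableSpace S] (μ : Measure S) (P : Kernel S S)
    [IsMarkovKernel P] : Measure (ℕ → S) :=
  Kernel.trajMeasure (X := fun _ => S) μ
    (fun n => P.comap (fun ω : (Π _ : Finset.Iic n, S) => ω ⟨n, Finset.mem_Iic.2 le_rfl⟩)
      (measurable_pi_apply _))

/-- The asymptotic variance of `h` along the chain with kernel `P` started from `μ`
exists and equals the (finite) number `v`: `n Var[(1/n) ∑_{i=1}^n h(X_i)] → v`, with the chain
`X_1, X_2, …` written as `ω 0, ω 1, …`. -/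
def HasAsymptoticVariance {S : Type*} [MeasurableSpace S] (P : Kernel S S) [IsMarkovKernel P]
    (μ : Measure S) (h : S → ℝ) (v : ℝ) : Prop :=
  Tendsto (fun n : ℕ => (n : ℝ) *
    variance (fun ω : ℕ → S => (1 / (n : ℝ)) * ∑ i ∈ Finset.range n, h (ω i)) (chainLaw μ P))
    atTop (𝓝 v)

/-- A Markov kernel with stationary distribution `μ` is variance bounding if every
`h ∈ L²(μ)` has a finite asymptotic variance. -/
def VarianceBounding {S : Type*} [MeasurableSpace S] (P : Kernel S S) [IsMarkovKernel P]
    (μ : Measure S) : Prop :=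
  Kernel.Invariant P μ ∧ ∀ h : S → ℝ, MemLp h 2 μ → ∃ v : ℝ, HasAsymptoticVariance P μ h v

end DelayedAcceptance

namespace DelayedAcceptance

/-! ### Symmetric contractions of a Hilbert space -/

open scoped InnerProductSpace

/-! For reversible kernels, variance bounding is equivalent to a spectral gap at 1, and a spectral
gap is a lower bound on the Dirichlet form `½ ∫∫ (f x - f y)² μ(dx) P(x, dy)`. Such a bound passes
to any kernel whose Dirichlet form is larger up to a constant factor.

The equivalence is proved without spectral theory. Let `T` be the transition operator on `L²(μ)`
minus the projection onto constants. The scaled variance of `h` is, up to the square of its mean,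
`n⁻¹ ⟪h, covSum T n h⟫`. If these forms converge for every `h`, Banach-Steinhaus bounds the
operators `n⁻¹ covSum T n` uniformly, and the mean ergodic theorem then makes `1 - T` bounded below
(`exists_gap_of_bounded`). Conversely, under a gap the equation `y - T y = h` has a solution, and
the forms telescope to a limit (`exists_tendsto_of_gap`).

Rejected moves do not contribute to the Dirichlet form, so `VarianceBounding.of_accept_le` only
needs a comparison of the accepted fluxes `π(x) q(x,y) α(x,y)`. For Metropolis-Hastings the flux is
`min (π(x)q(x,y)) (π(y)q(y,x))`; for delayed acceptance it is the same minimum with `πhat`, times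
`min (π(x)/πhat(x)) (π(y)/πhat(y))`. The bounds on `πhat/π` make the former at most `γhi/γlo` times
the latter (`flux_acceptMH_le`). -/

/-- The double sum `∑_{i,j<n} P^|i-j|`. -/
def covSum {R : Type*} [Ring R] (P : R) : ℕ → R
  | 0 => 0
  | n + 1 => covSum P n + (1 + 2 * ∑ k ∈ Finset.range n, P ^ (k + 1))

/-- Each row of the double sum telescopes against `1 - P`. After division by `n`, the subtracted
term is twice an ergodic average. -/
theorem covSum_mul_one_sub {R : Type*} [Ring R] (P : R) (n : ℕ) :
    covSum P n * (1 - P) = n * (1 + P) - 2 * ∑ k ∈ Finset.range n, P ^ (k + 1) := by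
  induction n with
  | zero => simp [covSum]
  | succ n ih =>
    have h : (∑ k ∈ Finset.range n, P ^ (k + 1)) * (1 - P) = P - P ^ (n + 1) := by
      simp_rw [pow_succ _ _, ← Finset.sum_mul, mul_assoc]
      have hc : Commute P (1 - P) := (Commute.one_right P).sub_right (Commute.refl P)
      rw [hc.eq, ← mul_assoc, geom_sum_mul_neg, sub_mul, one_mul]
    rw [covSum, add_mul, ih, add_mul, mul_assoc, h, Finset.sum_range_succ]
    push_cast
    noncomm_ring

variable {E : Type*} [NormedAddCommGroup E] [InnerProductSpace ℝ E]

theorem inner_pow_symm {P : E →L[ℝ] E} (hP : ∀ x y, ⟪P x, y⟫_ℝ = ⟪x, P y⟫_ℝ) (n : ℕ) (x y : E) :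
    ⟪(P ^ n) x, y⟫_ℝ = ⟪x, (P ^ n) y⟫_ℝ := by
  induction n generalizing x y with
  | zero => simp
  | succ n ih =>
    rw [pow_succ, mul_apply_eq_comp, ih, hP, ← mul_apply_eq_comp,
      ← pow_succ', pow_succ]

theorem covSum_succ_apply (P : E →L[ℝ] E) (n : ℕ) (x : E) :
    covSum P (n + 1) x =
      covSum P n x + (x + (2 : ℝ) • ∑ k ∈ Finset.range n, (P ^ (k + 1)) x) := by
  have h2 : (2 : E →L[ℝ] E) = (2 : ℝ) • 1 := by
    rw [two_smul, one_add_one_eq_two]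
  simp [covSum, h2]

theorem inner_covSum_symm {P : E →L[ℝ] E} (hP : ∀ x y, ⟪P x, y⟫_ℝ = ⟪x, P y⟫_ℝ) (n : ℕ)
    (x y : E) : ⟪covSum P n x, y⟫_ℝ = ⟪x, covSum P n y⟫_ℝ := by
  induction n with
  | zero => simp [covSum]
  | succ n ih =>
    simp only [covSum_succ_apply, inner_add_left, inner_add_right, real_inner_smul_left,
      real_inner_smul_right, sum_inner, inner_sum, ih, inner_pow_symm hP]

theorem covSum_apply_sub (P : E →L[ℝ] E) (n : ℕ) (x : E) :
    covSum P n (x - P x) =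
      (n : ℝ) • (x + P x) - (2 : ℝ) • ∑ k ∈ Finset.range n, (P ^ (k + 1)) x := by
  have h2 : (2 : E →L[ℝ] E) = (2 : ℝ) • 1 := by
    rw [two_smul, one_add_one_eq_two]
  have hn : (n : E →L[ℝ] E) = (n : ℝ) • 1 := by ext; simp [← Nat.cast_smul_eq_nsmul ℝ]
  have := congrArg (fun T : E →L[ℝ] E => T x) (covSum_mul_one_sub P n)
  simpa [h2, hn, sum_apply, Finset.smul_sum] using this

theorem norm_apply_le_of_contraction {P : E →L[ℝ] E} (h1 : ‖P‖ ≤ 1) (x : E) : ‖P x‖ ≤ ‖x‖ :=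
  (P.le_of_opNorm_le h1 x).trans_eq (one_mul _)

theorem norm_pow_apply_le {P : E →L[ℝ] E} (h1 : ‖P‖ ≤ 1) (n : ℕ) (x : E) :
    ‖(P ^ n) x‖ ≤ ‖x‖ := by
  induction n with
  | zero => simp
  | succ n ih =>
    rw [pow_succ', mul_apply_eq_comp]
    exact (norm_apply_le_of_contraction h1 _).trans ih

/-- Converts a lower bound on `‖x - P x‖` into one on the quadratic form of `1 - P`. Only spectrum
near 1 matters; spectrum near -1 is harmless. -/
theorem norm_sub_sq_le {P : E →L[ℝ] E} (h1 : ‖P‖ ≤ 1) (x : E) :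
    ‖x - P x‖ ^ 2 ≤ 2 * ⟪x, x - P x⟫_ℝ := by
  have h := norm_apply_le_of_contraction h1 x
  rw [norm_sub_sq_real, inner_sub_right, real_inner_self_eq_norm_sq]
  nlinarith [norm_nonneg (P x)]

/-- Spectral gap of a symmetric contraction whose normalised quadratic forms `covSum` are
pointwise bounded. -/
theorem exists_gap_of_bounded [CompleteSpace E] {P : E →L[ℝ] E}
    (hP : ∀ x y, ⟪P x, y⟫_ℝ = ⟪x, P y⟫_ℝ) (h1 : ‖P‖ ≤ 1)
    (hb : ∀ x, ∃ C, ∀ n : ℕ, |(n : ℝ)⁻¹ * ⟪x, covSum P n x⟫_ℝ| ≤ C) :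
    ∃ c > 0, ∀ x, c * ‖x‖ ^ 2 ≤ ⟪x, x - P x⟫_ℝ := by
  -- On a fixed vector every power acts as the identity, so the normalised form equals `n ‖x‖²`,
  -- which is unbounded unless `x = 0`.
  have hfix : ∀ x, P x = x → x = 0 := by
    intro x hx
    have hpow : ∀ k, (P ^ k) x = x := by
      intro k
      induction k with
      | zero => simp
      | succ k ih => rw [pow_succ, mul_apply_eq_comp, hx, ih]
    have hcov : ∀ n, covSum P n x = ((n : ℝ) ^ 2) • x := by
      intro n
      induction n with
      | zero => simp [covSum]
      | succ n ih =>
        rw [covSum_succ_apply, ih]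
        simp only [hpow, Finset.sum_const, Finset.card_range, ← Nat.cast_smul_eq_nsmul ℝ]
        push_cast
        module
    obtain ⟨C, hC⟩ := hb x
    by_contra hne
    have hpos : 0 < ‖x‖ ^ 2 := by positivity
    obtain ⟨n, hn⟩ := exists_nat_gt (C / ‖x‖ ^ 2)
    have h := (le_abs_self _).trans (hC (n + 1))
    rw [hcov, real_inner_smul_right, real_inner_self_eq_norm_sq] at h
    rw [div_lt_iff₀ hpos] at hn
    have hn0 : ((n + 1 : ℕ) : ℝ) ≠ 0 := by positivity
    have : ((n + 1 : ℕ) : ℝ)⁻¹ * (((n + 1 : ℕ) : ℝ) ^ 2 * ‖x‖ ^ 2) = (n + 1 : ℕ) * ‖x‖ ^ 2 := by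
      field_simp
    rw [this] at h
    push_cast at h
    nlinarith
  let A : ℕ → E →L[ℝ] E := fun n => (n : ℝ)⁻¹ • covSum P n
  have hA : ∀ n x, A n x = (n : ℝ)⁻¹ • covSum P n x := fun _ _ => rfl
  have hpol : ∀ n x y, 4 * ⟪y, A n x⟫_ℝ = (n : ℝ)⁻¹ * ⟪x + y, covSum P n (x + y)⟫_ℝ
      - (n : ℝ)⁻¹ * ⟪x - y, covSum P n (x - y)⟫_ℝ := by
    intro n x y
    have h := inner_covSum_symm hP n x y
    rw [real_inner_comm] at h
    simp only [hA, map_add, map_sub, inner_add_left, inner_add_right, inner_sub_left,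
      inner_sub_right, real_inner_smul_right, h]
    ring
  -- Uniform boundedness is used twice: polarisation bounds `⟪y, A n x⟫` for each pair, hence `A n
  -- x` for each `x`, hence `A n`.
  obtain ⟨C, hC⟩ : ∃ C, ∀ n, ‖A n‖ ≤ C := by
    refine banach_steinhaus fun x => ?_
    obtain ⟨C, hC⟩ : ∃ C, ∀ n, ‖innerSL ℝ (A n x)‖ ≤ C := by
      refine banach_steinhaus fun y => ?_
      obtain ⟨C1, h1⟩ := hb (x + y)
      obtain ⟨C2, h2⟩ := hb (x - y)
      refine ⟨(C1 + C2) / 4, fun n => ?_⟩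
      have := hpol n x y
      rw [innerSL_apply_apply, real_inner_comm, Real.norm_eq_abs, abs_le]
      have a1 := abs_le.1 (h1 n)
      have a2 := abs_le.1 (h2 n)
      constructor <;> linarith
    exact ⟨C, fun n => by simpa using hC n⟩
  have hC0 : 0 ≤ C := (norm_nonneg _).trans (hC 0)
  -- Mean ergodic theorem: the averages tend to the projection onto the fixed space, which is zero
  -- by `hfix`. It is applied to `P x` because the powers start at 1.
  have herg : ∀ x, Tendsto (fun n : ℕ => (n : ℝ)⁻¹ • ∑ k ∈ Finset.range n, (P ^ (k + 1)) x)
      atTop (𝓝 0) := by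
    intro x
    have h := P.tendsto_birkhoffAverage_orthogonalProjection h1 (P x)
    have h0 : ((P.eqLocus (1 : E →L[ℝ] E)).orthogonalProjectionOnto (P x) : E) = 0 :=
      hfix _ ((P.eqLocus (1 : E →L[ℝ] E)).orthogonalProjectionOnto (P x)).2
    rw [h0] at h
    refine h.congr fun n => ?_
    simp only [birkhoffAverage, birkhoffSum, id]
    congr 1
    refine Finset.sum_congr rfl fun k _ => ?_
    rw [pow_succ, mul_apply_eq_comp, ← ContinuousLinearMap.coe_coe (P ^ k),
      ContinuousLinearMap.toLinearMap_pow, Module.End.coe_pow, ContinuousLinearMap.coe_coe]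
  have hinv : ∀ x, 2 * ‖x‖ ≤ (C + 1) * ‖x - P x‖ := by
    intro x
    have hle : ∀ n : ℕ, 0 < n → 2 * ‖x‖ ≤ (C + 1) * ‖x - P x‖ +
        2 * ‖(n : ℝ)⁻¹ • ∑ k ∈ Finset.range n, (P ^ (k + 1)) x‖ := by
      intro n hn
      have hn0 : (n : ℝ) ≠ 0 := by positivity
      -- `covSum_apply_sub` divided by `n`, with `x + P x` rewritten as `2x - (x - P x)`.
      have e : (2 : ℝ) • x = A n (x - P x) + (x - P x) +
          (2 : ℝ) • (n : ℝ)⁻¹ • ∑ k ∈ Finset.range n, (P ^ (k + 1)) x := by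
        rw [hA, covSum_apply_sub, smul_sub, inv_smul_smul₀ hn0, smul_comm (n : ℝ)⁻¹ (2 : ℝ)]
        module
      have := congrArg norm e
      rw [norm_smul, Real.norm_two] at this
      rw [this]
      refine (norm_add₃_le).trans ?_
      rw [norm_smul (2 : ℝ), Real.norm_two, add_mul, one_mul]
      gcongr
      exact (A n).le_of_opNorm_le (hC n) _
    have ht : Tendsto (fun n : ℕ => (C + 1) * ‖x - P x‖ +
        2 * ‖(n : ℝ)⁻¹ • ∑ k ∈ Finset.range n, (P ^ (k + 1)) x‖) atTop
        (𝓝 ((C + 1) * ‖x - P x‖)) := by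
      simpa using ((herg x).norm.const_mul 2).const_add ((C + 1) * ‖x - P x‖)
    exact ge_of_tendsto ht ((eventually_gt_atTop 0).mono hle)
  -- Squaring `hinv` gives `4‖x‖² ≤ (C+1)² ‖x - P x‖²`, and `norm_sub_sq_le` costs a factor 2.
  refine ⟨2 / (C + 1) ^ 2, by positivity, fun x => ?_⟩
  have h2 := norm_sub_sq_le h1 x
  have h3 := pow_le_pow_left₀ (by positivity) (hinv x) 2
  rw [div_mul_eq_mul_div, div_le_iff₀ (by positivity)]
  nlinarith [sq_nonneg (C + 1)]

/-- Under a spectral gap the normalised quadratic forms `covSum` converge. -/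
theorem exists_tendsto_of_gap [CompleteSpace E] {P : E →L[ℝ] E}
    (hP : ∀ x y, ⟪P x, y⟫_ℝ = ⟪x, P y⟫_ℝ) (h1 : ‖P‖ ≤ 1) {c : ℝ} (hc : 0 < c)
    (hgap : ∀ x, c * ‖x‖ ^ 2 ≤ ⟪x, x - P x⟫_ℝ) (x : E) :
    ∃ v, Tendsto (fun n : ℕ => (n : ℝ)⁻¹ * ⟪x, covSum P n x⟫_ℝ) atTop (𝓝 v) := by
  -- Poisson equation: the gap is coercivity of the form of `1 - P`, so Lax-Milgram inverts `1 - P`.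
  obtain ⟨y, rfl⟩ : ∃ y, y - P y = x := by
    let B : E →L[ℝ] E →L[ℝ] ℝ := (innerSL ℝ).comp (1 - P)
    have hB : IsCoercive B := ⟨c, hc, fun u => by
      have := hgap u
      simp only [B, ContinuousLinearMap.comp_apply, innerSL_apply_apply]
      rw [real_inner_comm]
      simpa [pow_two, mul_assoc] using this⟩
    refine ⟨hB.continuousLinearEquivOfBilin.symm x, ?_⟩
    have h : ∀ u, hB.continuousLinearEquivOfBilin u = u - P u := fun u =>
      ext_inner_right ℝ fun w => by
        rw [hB.continuousLinearEquivOfBilin_apply]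
        simp [B, inner_sub_left]
    rw [← h, ContinuousLinearEquiv.apply_symm_apply]
  refine ⟨⟪y - P y, y + P y⟫_ℝ, ?_⟩
  -- By symmetry `⟪P y, P^(k+1) y⟫ = ⟪y, P^(k+2) y⟫`, so the sum telescopes; it stays bounded in `n`
  -- and vanishes after division by `n`.
  have htel : ∀ n : ℕ, ⟪y - P y, ∑ k ∈ Finset.range n, (P ^ (k + 1)) y⟫_ℝ
      = ⟪y, P y⟫_ℝ - ⟪y, (P ^ (n + 1)) y⟫_ℝ := by
    intro n
    induction n with
    | zero => simp
    | succ n ih =>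
      rw [Finset.sum_range_succ, inner_add_right, ih, inner_sub_left, hP,
        ← mul_apply_eq_comp, ← pow_succ']
      ring
  have hz : Tendsto (fun n : ℕ => (n : ℝ)⁻¹ * (⟪y, P y⟫_ℝ - ⟪y, (P ^ (n + 1)) y⟫_ℝ))
      atTop (𝓝 0) := by
    refine tendsto_inv_atTop_nhds_zero_nat.zero_mul_isBoundedUnder_le ?_
    refine isBoundedUnder_of ⟨2 * (‖y‖ * ‖y‖), fun n => ?_⟩
    have a : ∀ k, |⟪y, (P ^ k) y⟫_ℝ| ≤ ‖y‖ * ‖y‖ := fun k =>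
      (abs_real_inner_le_norm _ _).trans (by gcongr; exact norm_pow_apply_le h1 k y)
    have a1 := a 1
    rw [pow_one] at a1
    exact (norm_sub_le _ _).trans (by simpa [two_mul] using add_le_add a1 (a (n + 1)))
  have := (hz.const_mul 2).const_sub ⟪y - P y, y + P y⟫_ℝ
  rw [mul_zero, sub_zero] at this
  refine this.congr' ((eventually_gt_atTop 0).mono fun n hn => ?_)
  have hn0 : (n : ℝ) ≠ 0 := by positivity
  dsimp only
  rw [covSum_apply_sub, inner_sub_right _ (_ • _), real_inner_smul_right, real_inner_smul_right,
    htel]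
  field_simp

end DelayedAcceptance

namespace DelayedAcceptance

open scoped InnerProductSpace

/-! ### The transition operator on `L²` -/

variable {S : Type*} [MeasurableSpace S] {P : Kernel S S} [IsMarkovKernel P] {μ : Measure S}
  [IsProbabilityMeasure μ]

theorem measurePreserving_fst_compProd (P : Kernel S S) [IsMarkovKernel P] (μ : Measure S)
    [SFinite μ] : MeasurePreserving Prod.fst (μ ⊗ₘ P) μ :=
  ⟨measurable_fst, Measure.fst_compProd μ P⟩

theorem measurePreserving_snd_compProd (hP : Kernel.Invariant P μ) :
    MeasurePreserving Prod.snd (μ ⊗ₘ P) μ :=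
  ⟨measurable_snd, (Measure.snd_compProd μ P).trans hP⟩

/-- `f ↦ f(X₁)`, for a stationary pair `(X₁, X₂)`. -/
noncomputable def fstL2 (P : Kernel S S) [IsMarkovKernel P] (μ : Measure S)
    [IsProbabilityMeasure μ] : Lp ℝ 2 μ →ₗᵢ[ℝ] Lp ℝ 2 (μ ⊗ₘ P) :=
  Lp.compMeasurePreservingₗᵢ ℝ Prod.fst (measurePreserving_fst_compProd P μ)

/-- `f ↦ f(X₂)`, for a stationary pair `(X₁, X₂)`. -/
noncomputable def sndL2 (hP : Kernel.Invariant P μ) : Lp ℝ 2 μ →ₗᵢ[ℝ] Lp ℝ 2 (μ ⊗ₘ P) :=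
  Lp.compMeasurePreservingₗᵢ ℝ Prod.snd (measurePreserving_snd_compProd hP)

theorem fstL2_ae (f : Lp ℝ 2 μ) : fstL2 P μ f =ᵐ[μ ⊗ₘ P] fun z => f z.1 :=
  Lp.coeFn_compMeasurePreserving f (measurePreserving_fst_compProd P μ)

theorem sndL2_ae (hP : Kernel.Invariant P μ) (f : Lp ℝ 2 μ) :
    sndL2 hP f =ᵐ[μ ⊗ₘ P] fun z => f z.2 :=
  Lp.coeFn_compMeasurePreserving f (measurePreserving_snd_compProd hP)

/-- The transition operator of `P` on `L²(μ)`. -/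
noncomputable def transOp (hP : Kernel.Invariant P μ) : Lp ℝ 2 μ →L[ℝ] Lp ℝ 2 μ :=
  (fstL2 P μ).toContinuousLinearMap.adjoint ∘L (sndL2 hP).toContinuousLinearMap

theorem inner_transOp (hP : Kernel.Invariant P μ) (f g : Lp ℝ 2 μ) :
    ⟪f, transOp hP g⟫_ℝ = ⟪fstL2 P μ f, sndL2 hP g⟫_ℝ := by
  simp [transOp, ContinuousLinearMap.adjoint_inner_right]

/-- Cauchy-Schwarz in `L²(μ ⊗ₘ P)`: the form `⟪g, transOp hP f⟫` with `g = transOp hP f` pairs two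
isometric images. -/
theorem norm_transOp_apply_le (hP : Kernel.Invariant P μ) (f : Lp ℝ 2 μ) :
    ‖transOp hP f‖ ≤ ‖f‖ := by
  by_cases h : ‖transOp hP f‖ = 0
  · rw [h]; exact norm_nonneg _
  have h1 : ‖transOp hP f‖ * ‖transOp hP f‖ ≤ ‖transOp hP f‖ * ‖f‖ := by
    rw [← real_inner_self_eq_norm_mul_norm, inner_transOp]
    refine (real_inner_le_norm _ _).trans_eq ?_
    rw [LinearIsometry.norm_map, LinearIsometry.norm_map]
  exact le_of_mul_le_mul_left h1 (lt_of_le_of_ne (norm_nonneg _) (Ne.symm h))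

theorem integrable_coe_Lp (f : Lp ℝ 2 μ) : Integrable f μ :=
  (Lp.memLp f).integrable one_le_two

theorem integrable_snd_compProd (hP : Kernel.Invariant P μ) (f : Lp ℝ 2 μ) :
    Integrable (fun z : S × S => f z.2) (μ ⊗ₘ P) :=
  (measurePreserving_snd_compProd hP).integrable_comp_of_integrable (integrable_coe_Lp f)

/-- The adjoint of `f ↦ f(X₁)` is conditional expectation given `X₁`; testing against indicators
identifies it with integration against the kernel. -/
theorem transOp_ae (hP : Kernel.Invariant P μ) (f : Lp ℝ 2 μ) :
    transOp hP f =ᵐ[μ] fun x => ∫ y, f y ∂(P x) := by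
  have hi := integrable_snd_compProd hP f
  refine Integrable.ae_eq_of_forall_setIntegral_eq _ _ (integrable_coe_Lp _)
    (Integrable.integral_compProd hi) fun A hA hA' => ?_
  rw [← L2.inner_indicatorConstLp_one (𝕜 := ℝ) hA hA'.ne, inner_transOp]
  have e : fstL2 P μ (indicatorConstLp 2 hA hA'.ne (1 : ℝ)) =
      indicatorConstLp 2 (measurable_fst hA) (measure_ne_top (μ ⊗ₘ P) _) (1 : ℝ) := rfl
  rw [e, L2.inner_indicatorConstLp_one (𝕜 := ℝ),
    setIntegral_congr_ae (measurable_fst hA) ((sndL2_ae hP f).mono fun z hz _ => hz)]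
  have := Measure.setIntegral_compProd hA MeasurableSet.univ hi.integrableOn
  rw [Set.prod_univ] at this
  simpa using this

/-- The transition operator with the constants split off. -/
noncomputable def centeredOp (hP : Kernel.Invariant P μ) : Lp ℝ 2 μ →L[ℝ] Lp ℝ 2 μ :=
  transOp hP - (innerSL ℝ (Lp.const 2 μ (1 : ℝ))).smulRight (Lp.const 2 μ (1 : ℝ))

theorem centeredOp_apply (hP : Kernel.Invariant P μ) (f : Lp ℝ 2 μ) :
    centeredOp hP f = transOp hP f - ⟪Lp.const 2 μ (1 : ℝ), f⟫_ℝ • Lp.const 2 μ (1 : ℝ) := by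
  simp [centeredOp]

theorem inner_const_one (f : Lp ℝ 2 μ) : ⟪Lp.const 2 μ (1 : ℝ), f⟫_ℝ = ∫ x, f x ∂μ := by
  have := L2.inner_indicatorConstLp_one (𝕜 := ℝ) MeasurableSet.univ (measure_ne_top μ _) f
  rwa [indicatorConstLp_univ, setIntegral_univ] at this

theorem inner_const_one_self : ⟪Lp.const 2 μ (1 : ℝ), Lp.const 2 μ (1 : ℝ)⟫_ℝ = 1 := by
  rw [inner_const_one, integral_congr_ae (Lp.coeFn_const 2 μ (1 : ℝ))]
  simp

theorem transOp_const (hP : Kernel.Invariant P μ) :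
    transOp hP (Lp.const 2 μ (1 : ℝ)) = Lp.const 2 μ (1 : ℝ) := by
  refine ext_inner_left ℝ fun f => ?_
  have e : sndL2 hP (Lp.const 2 μ (1 : ℝ)) = fstL2 P μ (Lp.const 2 μ (1 : ℝ)) := rfl
  rw [inner_transOp, e, LinearIsometry.inner_map_map]

theorem inner_const_transOp (hP : Kernel.Invariant P μ) (f : Lp ℝ 2 μ) :
    ⟪Lp.const 2 μ (1 : ℝ), transOp hP f⟫_ℝ = ⟪Lp.const 2 μ (1 : ℝ), f⟫_ℝ := by
  have e : sndL2 hP (Lp.const 2 μ (1 : ℝ)) = fstL2 P μ (Lp.const 2 μ (1 : ℝ)) := rfl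
  rw [inner_transOp, ← e, LinearIsometry.inner_map_map]

/-- Constants are fixed by the transition operator and by its adjoint, so the projection is
subtracted just once. The exponent must be positive: the zeroth power is the identity, with nothing
subtracted. -/
theorem centeredOp_pow_apply (hP : Kernel.Invariant P μ) (n : ℕ) (f : Lp ℝ 2 μ) :
    (centeredOp hP ^ (n + 1)) f =
      (transOp hP ^ (n + 1)) f - ⟪Lp.const 2 μ (1 : ℝ), f⟫_ℝ • Lp.const 2 μ (1 : ℝ) := by
  induction n generalizing f with
  | zero => simp [centeredOp_apply]
  | succ n ih =>
    have hone : ∀ k, (transOp hP ^ k) (Lp.const 2 μ (1 : ℝ)) = Lp.const 2 μ (1 : ℝ) := by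
      intro k
      induction k with
      | zero => simp
      | succ k ih => rw [pow_succ, mul_apply_eq_comp, transOp_const, ih]
    rw [pow_succ, mul_apply_eq_comp, ih, centeredOp_apply, map_sub, map_smul, hone, inner_sub_right,
      inner_const_transOp, real_inner_smul_right, inner_const_one_self, pow_succ _ (n + 1),
      mul_apply_eq_comp]
    simp

theorem norm_centeredOp_le (hP : Kernel.Invariant P μ) : ‖centeredOp hP‖ ≤ 1 := by
  refine ContinuousLinearMap.opNorm_le_bound _ zero_le_one fun f => ?_
  set e := Lp.const 2 μ (1 : ℝ) with he
  -- Centering followed by the transition operator: an orthogonal projection and then a contraction.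
  have h : centeredOp hP f = transOp hP (f - ⟪e, f⟫_ℝ • e) := by
    rw [centeredOp_apply, map_sub, map_smul, transOp_const]
  rw [h, one_mul]
  refine (norm_transOp_apply_le hP _).trans ?_
  refine (sq_le_sq₀ (norm_nonneg _) (norm_nonneg _)).1 ?_
  have he1 : ‖e‖ ^ 2 = 1 := by rw [← real_inner_self_eq_norm_sq, he, inner_const_one_self]
  rw [norm_sub_sq_real, real_inner_smul_right, real_inner_comm, norm_smul, mul_pow, he1,
    Real.norm_eq_abs, sq_abs]
  nlinarith [sq_nonneg ⟪e, f⟫_ℝ]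

/-! ### The stationary chain -/

theorem chainLaw_map_succ (P : Kernel S S) [IsMarkovKernel P] (μ : Measure S)
    [IsProbabilityMeasure μ] (n : ℕ) :
    (chainLaw μ P).map (fun ω => (Preorder.frestrictLe n ω, ω (n + 1))) =
      (chainLaw μ P).map (Preorder.frestrictLe n) ⊗ₘ
        P.comap (fun ω : (Π _ : Finset.Iic n, S) => ω ⟨n, Finset.mem_Iic.2 le_rfl⟩)
          (measurable_pi_apply _) :=
  Kernel.map_frestrictLe_trajMeasure_compProd_eq_map_trajMeasure.symm

instance (P : Kernel S S) [IsMarkovKernel P] (μ : Measure S) [IsProbabilityMeasure μ] :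
    IsProbabilityMeasure (chainLaw μ P) := by
  unfold chainLaw; infer_instance

theorem measurable_frestrictLe_const (n : ℕ) :
    Measurable (Preorder.frestrictLe (π := fun _ : ℕ => S) n) :=
  Preorder.measurable_frestrictLe n

theorem chainLaw_map_zero (P : Kernel S S) [IsMarkovKernel P] (μ : Measure S)
    [IsProbabilityMeasure μ] : (chainLaw μ P).map (fun ω => ω 0) = μ := by
  have h : (chainLaw μ P).map (Preorder.frestrictLe 0) =
      μ.map (MeasurableEquiv.piUnique (fun _ : Finset.Iic 0 => S)).symm := by
    rw [chainLaw, Kernel.trajMeasure, Measure.map_comp _ _ (by fun_prop),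
      Kernel.traj_map_frestrictLe, Kernel.partialTraj_self, Measure.id_comp]
  have h2 : (fun ω : ℕ → S => ω 0) =
      (fun w : (Π _ : Finset.Iic 0, S) => w ⟨0, by simp⟩) ∘ Preorder.frestrictLe 0 := rfl
  rw [h2, ← Measure.map_map (measurable_pi_apply _) (measurable_frestrictLe_const 0), h,
    Measure.map_map (measurable_pi_apply _) (by fun_prop)]
  exact Measure.map_id

theorem measurePreserving_coord (hP : Kernel.Invariant P μ) (n : ℕ) :
    MeasurePreserving (fun ω : ℕ → S => ω n) (chainLaw μ P) μ := by
  refine ⟨measurable_pi_apply n, ?_⟩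
  induction n with
  | zero => exact chainLaw_map_zero P μ
  | succ n ih =>
    have h := congrArg Measure.snd (chainLaw_map_succ P μ n)
    rw [Measure.snd, Measure.map_map measurable_snd
      ((measurable_frestrictLe_const n).prodMk (measurable_pi_apply _)),
      Measure.snd_compProd] at h
    have : IsProbabilityMeasure ((chainLaw μ P).map (Preorder.frestrictLe n)) :=
      Measure.isProbabilityMeasure_map (measurable_frestrictLe_const n).aemeasurable
    refine Eq.trans h ?_
    ext A hA
    rw [Measure.bind_apply hA (Kernel.aemeasurable _), lintegral_map
      (Kernel.measurable_coe _ hA) (measurable_frestrictLe_const n)]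
    have h2 : ∀ ω : ℕ → S, P.comap
        (fun w : (Π _ : Finset.Iic n, S) => w ⟨n, Finset.mem_Iic.2 le_rfl⟩)
          (measurable_pi_apply _) (Preorder.frestrictLe n ω) A = P (ω n) A := fun _ => rfl
    simp_rw [h2]
    rw [← lintegral_map (f := fun x => P x A) (Kernel.measurable_coe _ hA) (measurable_pi_apply n),
      ih, ← Measure.bind_apply hA (Kernel.aemeasurable _), hP.def]

/-- `f ↦ f(X_n)` for the stationary chain. -/
noncomputable def coordL2 (hP : Kernel.Invariant P μ) (n : ℕ) :
    Lp ℝ 2 μ →ₗᵢ[ℝ] Lp ℝ 2 (chainLaw μ P) :=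
  Lp.compMeasurePreservingₗᵢ ℝ (fun ω => ω n) (measurePreserving_coord hP n)

theorem coordL2_ae (hP : Kernel.Invariant P μ) (n : ℕ) (f : Lp ℝ 2 μ) :
    coordL2 hP n f =ᵐ[chainLaw μ P] fun ω => f (ω n) :=
  Lp.coeFn_compMeasurePreserving f (measurePreserving_coord hP n)

theorem inner_coordL2 (hP : Kernel.Invariant P μ) (m n : ℕ) (f g : Lp ℝ 2 μ) :
    ⟪coordL2 hP m f, coordL2 hP n g⟫_ℝ = ∫ ω, f (ω m) * g (ω n) ∂(chainLaw μ P) := by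
  rw [L2.inner_def]
  refine integral_congr_ae ?_
  filter_upwards [coordL2_ae hP m f, coordL2_ae hP n g] with ω h1 h2
  rw [h1, h2, real_inner_eq_re_inner, RCLike.inner_apply]
  simp [mul_comm]

theorem integrable_coord_mul (hP : Kernel.Invariant P μ) (m n : ℕ) (f g : Lp ℝ 2 μ) :
    Integrable (fun ω => f (ω m) * g (ω n)) (chainLaw μ P) :=
  MemLp.integrable_mul ((Lp.memLp f).comp_measurePreserving (measurePreserving_coord hP m))
    ((Lp.memLp g).comp_measurePreserving (measurePreserving_coord hP n))

/-- The Markov property, on products. -/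
theorem inner_coordL2_succ (hP : Kernel.Invariant P μ) {m n : ℕ} (hmn : m ≤ n) (f g : Lp ℝ 2 μ) :
    ⟪coordL2 hP m f, coordL2 hP (n + 1) g⟫_ℝ = ⟪coordL2 hP m f, coordL2 hP n (transOp hP g)⟫_ℝ := by
  rw [inner_coordL2, inner_coordL2]
  have hmeas : Measurable fun ω : ℕ → S => (Preorder.frestrictLe n ω, ω (n + 1)) :=
    (measurable_frestrictLe_const n).prodMk (measurable_pi_apply _)
  have hf := (Lp.stronglyMeasurable f).measurable
  have hg := (Lp.stronglyMeasurable g).measurable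
  let F : (Π _ : Finset.Iic n, S) × S → ℝ := fun z => f (z.1 ⟨m, Finset.mem_Iic.2 hmn⟩) * g z.2
  have hF : StronglyMeasurable F :=
    ((hf.comp ((measurable_pi_apply _).comp measurable_fst)).mul
      (hg.comp measurable_snd)).stronglyMeasurable
  have : IsProbabilityMeasure ((chainLaw μ P).map (Preorder.frestrictLe n)) :=
    Measure.isProbabilityMeasure_map (measurable_frestrictLe_const n).aemeasurable
  have hFi : Integrable F ((chainLaw μ P).map fun ω => (Preorder.frestrictLe n ω, ω (n + 1))) :=
    (integrable_map_measure hF.aestronglyMeasurable hmeas.aemeasurable).2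
      (integrable_coord_mul hP m (n + 1) f g)
  have e1 : ∫ ω, f (ω m) * g (ω (n + 1)) ∂(chainLaw μ P) =
      ∫ z, F z ∂((chainLaw μ P).map fun ω => (Preorder.frestrictLe n ω, ω (n + 1))) :=
    (integral_map hmeas.aemeasurable hF.aestronglyMeasurable).symm
  rw [e1]
  -- Disintegration over the history up to time `n`: the factor at time `m` is known, and
  -- integrating out the next state yields `transOp hP g`.
  rw [chainLaw_map_succ] at hFi ⊢
  rw [Measure.integral_compProd hFi, integral_map (measurable_frestrictLe_const n).aemeasurable
    hF.integral_kernel_prod_right'.aestronglyMeasurable]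
  refine integral_congr_ae ?_
  filter_upwards [(measurePreserving_coord hP n).quasiMeasurePreserving.ae (transOp_ae hP g)]
    with ω hω
  rw [hω, ← integral_const_mul]
  rfl

theorem inner_coordL2_add (hP : Kernel.Invariant P μ) (m k : ℕ) (f g : Lp ℝ 2 μ) :
    ⟪coordL2 hP m f, coordL2 hP (m + k) g⟫_ℝ = ⟪f, (transOp hP ^ k) g⟫_ℝ := by
  induction k generalizing g with
  | zero => simp
  | succ k ih =>
    rw [← add_assoc, inner_coordL2_succ hP (Nat.le_add_right m k), ih, pow_succ,
      mul_apply_eq_comp]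

theorem covariance_coord (hP : Kernel.Invariant P μ) (m k : ℕ) (f : Lp ℝ 2 μ) :
    cov[fun ω => f (ω m), fun ω => f (ω (m + k)); chainLaw μ P] =
      ⟪f, (transOp hP ^ k) f⟫_ℝ - ⟪Lp.const 2 μ (1 : ℝ), f⟫_ℝ ^ 2 := by
  have hm : ∀ n, ∫ ω, f (ω n) ∂(chainLaw μ P) = ⟪Lp.const 2 μ (1 : ℝ), f⟫_ℝ := fun n => by
    have h := integral_map (μ := chainLaw μ P) (φ := fun ω : ℕ → S => ω n)
      (measurable_pi_apply n).aemeasurable (Lp.stronglyMeasurable f).aestronglyMeasurable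
    rwa [(measurePreserving_coord hP n).map_eq, ← inner_const_one, eq_comm] at h
  have hc := covariance_eq_sub ((Lp.memLp f).comp_measurePreserving (measurePreserving_coord hP m))
    ((Lp.memLp f).comp_measurePreserving (measurePreserving_coord hP (m + k)))
  refine hc.trans ?_
  rw [← inner_coordL2_add hP m k, inner_coordL2, pow_two]
  exact congrArg₂ _ rfl (congrArg₂ _ (hm m) (hm (m + k)))

/-- Covariances at positive lag are forms of powers of `centeredOp`. The `n` diagonal terms of
`covSum` are identities, hence uncentered, and the squared mean is subtracted once for each. -/
theorem variance_sum_coord (hP : Kernel.Invariant P μ) (f : Lp ℝ 2 μ) (n : ℕ) :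
    Var[fun ω => ∑ i ∈ Finset.range n, f (ω i); chainLaw μ P] =
      ⟪f, covSum (centeredOp hP) n f⟫_ℝ - n * ⟪Lp.const 2 μ (1 : ℝ), f⟫_ℝ ^ 2 := by
  have hL : ∀ i, MemLp (fun ω : ℕ → S => f (ω i)) 2 (chainLaw μ P) := fun i =>
    (Lp.memLp f).comp_measurePreserving (measurePreserving_coord hP i)
  induction n with
  | zero => simp [covSum, variance_zero, show (fun _ : ℕ → S => (0 : ℝ)) = 0 from rfl]
  | succ n ih =>
    simp_rw [Finset.sum_range_succ]
    rw [variance_fun_add (memLp_finsetSum _ fun i _ => hL i) (hL n), ih, covSum_succ_apply,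
      covariance_fun_sum_left' (fun i _ => hL i) (hL n), ← covariance_self (hL n).aemeasurable,
      show cov[fun ω => f (ω n), fun ω => f (ω n); chainLaw μ P] = _ from covariance_coord hP n 0 f]
    have hs : ∑ i ∈ Finset.range n, cov[fun ω => f (ω i), fun ω => f (ω n); chainLaw μ P] =
        ∑ k ∈ Finset.range n, ⟪f, (centeredOp hP ^ (k + 1)) f⟫_ℝ := by
      -- Reindexing by the lag: `i = n - 1 - k` lies `k + 1` steps before `n`.
      rw [← Finset.sum_range_reflect]
      refine Finset.sum_congr rfl fun k hk => ?_
      have hk := Finset.mem_range.1 hk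
      have := covariance_coord hP (n - 1 - k) (k + 1) f
      rw [show n - 1 - k + (k + 1) = n by omega] at this
      rw [this, centeredOp_pow_apply, inner_sub_right, real_inner_smul_right,
        real_inner_comm f, pow_two]
    rw [hs]
    simp only [inner_add_right, real_inner_smul_right, inner_sum, pow_zero,
      one_apply_eq_self]
    push_cast
    ring

/-- At `n = 0` the left side is 0 while the right side is minus the squared mean, hence `0 < n`. -/
theorem asymptoticVariance_seq (hP : Kernel.Invariant P μ) {h : S → ℝ} (hh : MemLp h 2 μ)
    {n : ℕ} (hn : 0 < n) :
    (n : ℝ) * variance (fun ω : ℕ → S => (1 / (n : ℝ)) * ∑ i ∈ Finset.range n, h (ω i))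
      (chainLaw μ P) =
    (n : ℝ)⁻¹ * ⟪hh.toLp h, covSum (centeredOp hP) n (hh.toLp h)⟫_ℝ
      - ⟪Lp.const 2 μ (1 : ℝ), hh.toLp h⟫_ℝ ^ 2 := by
  have hn0 : (n : ℝ) ≠ 0 := by positivity
  have hae : (fun ω : ℕ → S => ∑ i ∈ Finset.range n, h (ω i)) =ᵐ[chainLaw μ P]
      fun ω => ∑ i ∈ Finset.range n, hh.toLp h (ω i) := by
    have : ∀ i, ∀ᵐ ω ∂(chainLaw μ P), hh.toLp h (ω i) = h (ω i) := fun i =>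
      (measurePreserving_coord hP i).quasiMeasurePreserving.ae hh.coeFn_toLp
    filter_upwards [ae_all_iff.2 this] with ω hω
    simp [hω]
  rw [variance_const_mul, variance_congr hae, variance_sum_coord hP]
  field_simp

theorem hasAsymptoticVariance_iff (hP : Kernel.Invariant P μ) {h : S → ℝ} (hh : MemLp h 2 μ)
    (v : ℝ) : HasAsymptoticVariance P μ h v ↔
      Tendsto (fun n : ℕ => (n : ℝ)⁻¹ * ⟪hh.toLp h, covSum (centeredOp hP) n (hh.toLp h)⟫_ℝ)
        atTop (𝓝 (v + ⟪Lp.const 2 μ (1 : ℝ), hh.toLp h⟫_ℝ ^ 2)) := by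
  have e : (fun n : ℕ => (n : ℝ) * variance (fun ω : ℕ → S =>
        (1 / (n : ℝ)) * ∑ i ∈ Finset.range n, h (ω i)) (chainLaw μ P)) =ᶠ[atTop]
      fun n : ℕ => (n : ℝ)⁻¹ * ⟪hh.toLp h, covSum (centeredOp hP) n (hh.toLp h)⟫_ℝ
        - ⟪Lp.const 2 μ (1 : ℝ), hh.toLp h⟫_ℝ ^ 2 :=
    (eventually_gt_atTop 0).mono fun n hn => asymptoticVariance_seq hP hh hn
  rw [HasAsymptoticVariance, tendsto_congr' e]
  generalize ⟪Lp.const 2 μ (1 : ℝ), hh.toLp h⟫_ℝ ^ 2 = c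
  refine ⟨fun H => ?_, fun H => ?_⟩
  · simpa only [sub_add_cancel] using H.add_const c
  · simpa only [add_sub_cancel_right] using H.sub_const c

end DelayedAcceptance

namespace DelayedAcceptance
open scoped InnerProductSpace ENNReal

/-! ### Variance bounding and the spectral gap of reversible kernels -/

section Reversible

variable {S : Type*} [MeasurableSpace S] {P Q : Kernel S S} [IsMarkovKernel P] [IsMarkovKernel Q]
  {μ : Measure S} [IsProbabilityMeasure μ]

/-- Reversibility says that a stationary pair `(X₁, X₂)` is exchangeable; rectangles suffice to see
it. -/
theorem measurePreserving_swap_compProd (hP : Kernel.IsReversible P μ) :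
    MeasurePreserving Prod.swap (μ ⊗ₘ P) (μ ⊗ₘ P) := by
  refine ⟨measurable_swap, ?_⟩
  have : IsProbabilityMeasure ((μ ⊗ₘ P).map Prod.swap) :=
    Measure.isProbabilityMeasure_map measurable_swap.aemeasurable
  refine Measure.ext_prod fun {A B} hA hB => ?_
  rw [Measure.map_apply measurable_swap (hA.prod hB), Set.preimage_swap_prod,
    Measure.compProd_apply_prod hB hA, Measure.compProd_apply_prod hA hB]
  exact (hP hA hB).symm

theorem inner_fstL2_sndL2 (hP : Kernel.Invariant P μ) (f g : Lp ℝ 2 μ) :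
    ⟪fstL2 P μ f, sndL2 hP g⟫_ℝ = ∫ z, f z.1 * g z.2 ∂(μ ⊗ₘ P) := by
  rw [L2.inner_def]
  refine integral_congr_ae ?_
  filter_upwards [fstL2_ae (P := P) f, sndL2_ae hP g] with z h1 h2
  rw [h1, h2, real_inner_eq_re_inner, RCLike.inner_apply]
  simp [mul_comm]

theorem transOp_symm (hP : Kernel.IsReversible P μ) (f g : Lp ℝ 2 μ) :
    ⟪transOp hP.invariant f, g⟫_ℝ = ⟪f, transOp hP.invariant g⟫_ℝ := by
  rw [real_inner_comm, inner_transOp, inner_transOp, inner_fstL2_sndL2, inner_fstL2_sndL2,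
    ← (measurePreserving_swap_compProd hP).integral_comp
      MeasurableEquiv.prodComm.measurableEmbedding]
  exact integral_congr_ae (.of_forall fun z => mul_comm _ _)

theorem centeredOp_symm (hP : Kernel.IsReversible P μ) (f g : Lp ℝ 2 μ) :
    ⟪centeredOp hP.invariant f, g⟫_ℝ = ⟪f, centeredOp hP.invariant g⟫_ℝ := by
  rw [centeredOp_apply, centeredOp_apply, inner_sub_left, inner_sub_right, transOp_symm hP,
    real_inner_smul_left, real_inner_smul_right, real_inner_comm f, mul_comm]

/-- Dirichlet form plus squared mean. The second term supplies the gap on constants, so no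
restriction to the mean-zero subspace is needed. -/
theorem inner_sub_centeredOp (hP : Kernel.Invariant P μ) (f : Lp ℝ 2 μ) :
    ⟪f, f - centeredOp hP f⟫_ℝ =
      2⁻¹ * ‖fstL2 P μ f - sndL2 hP f‖ ^ 2 + ⟪Lp.const 2 μ (1 : ℝ), f⟫_ℝ ^ 2 := by
  rw [centeredOp_apply, inner_sub_right, inner_sub_right, real_inner_smul_right, inner_transOp,
    norm_sub_sq_real, LinearIsometry.norm_map, LinearIsometry.norm_map, real_inner_self_eq_norm_sq,
    real_inner_comm f]
  ring

/-- The spectral gap of the transition operator on the centered functions. -/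
def HasGap (hP : Kernel.Invariant P μ) : Prop :=
  ∃ c > 0, ∀ f : Lp ℝ 2 μ, c * ‖f‖ ^ 2 ≤ ⟪f, f - centeredOp hP f⟫_ℝ

theorem VarianceBounding.hasGap (hP : Kernel.IsReversible P μ) (h : VarianceBounding P μ) :
    HasGap hP.invariant := by
  refine exists_gap_of_bounded (centeredOp_symm hP) (norm_centeredOp_le _) fun f => ?_
  obtain ⟨v, hv⟩ := h.2 f (Lp.memLp f)
  rw [hasAsymptoticVariance_iff hP.invariant (Lp.memLp f), Lp.toLp_coeFn] at hv
  obtain ⟨C, hC⟩ := hv.abs.bddAbove_range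
  exact ⟨C, fun n => hC ⟨n, rfl⟩⟩

theorem HasGap.varianceBounding (hP : Kernel.IsReversible P μ) (h : HasGap hP.invariant) :
    VarianceBounding P μ := by
  refine ⟨hP.invariant, fun f hf => ?_⟩
  obtain ⟨c, hc, hgap⟩ := h
  obtain ⟨v, hv⟩ := exists_tendsto_of_gap (centeredOp_symm hP) (norm_centeredOp_le _) hc hgap
    (hf.toLp f)
  refine ⟨v - ⟪Lp.const 2 μ (1 : ℝ), hf.toLp f⟫_ℝ ^ 2, ?_⟩
  rwa [hasAsymptoticVariance_iff hP.invariant hf, sub_add_cancel]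

/-- The `ℝ≥0∞`-valued form lets two kernels be compared without integrability conditions. -/
theorem norm_fstL2_sub_sndL2_sq (hP : Kernel.Invariant P μ) (f : Lp ℝ 2 μ) :
    ENNReal.ofReal (‖fstL2 P μ f - sndL2 hP f‖ ^ 2) =
      ∫⁻ z, ENNReal.ofReal ((f z.1 - f z.2) ^ 2) ∂(μ ⊗ₘ P) := by
  rw [← real_inner_self_eq_norm_sq, L2.inner_def,
    ofReal_integral_eq_lintegral_ofReal (L2.integrable_inner _ _)
      (.of_forall fun z => real_inner_self_nonneg)]
  refine lintegral_congr_ae ?_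
  filter_upwards [fstL2_ae (P := P) f, sndL2_ae hP f, Lp.coeFn_sub (fstL2 P μ f) (sndL2 hP f)]
    with z h1 h2 h3
  rw [h3, Pi.sub_apply, h1, h2, real_inner_self_eq_norm_sq, Real.norm_eq_abs, sq_abs]

/-- Variance bounding is inherited by reversible kernels with a larger Dirichlet form. -/
theorem VarianceBounding.of_dirichletForm_le (hP : Kernel.IsReversible P μ)
    (hQ : Kernel.IsReversible Q μ) {C : ℝ} (hC : 0 ≤ C)
    (hle : ∀ f : S → ℝ, Measurable f → ∫⁻ z, ENNReal.ofReal ((f z.1 - f z.2) ^ 2) ∂(μ ⊗ₘ P) ≤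
      ENNReal.ofReal C * ∫⁻ z, ENNReal.ofReal ((f z.1 - f z.2) ^ 2) ∂(μ ⊗ₘ Q))
    (h : VarianceBounding P μ) : VarianceBounding Q μ := by
  obtain ⟨c, hc, hgap⟩ := h.hasGap hP
  -- The factor `C` serves the Dirichlet form; `C + 1` also dominates the coefficient 1 of the
  -- squared mean and is positive when `C = 0`.
  refine HasGap.varianceBounding hQ ⟨c / (C + 1), by positivity, fun f => ?_⟩
  have h1 := hgap f
  have h2 := hle f (Lp.stronglyMeasurable f).measurable
  rw [← norm_fstL2_sub_sndL2_sq hP.invariant, ← norm_fstL2_sub_sndL2_sq hQ.invariant,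
    ← ENNReal.ofReal_mul hC, ENNReal.ofReal_le_ofReal_iff (by positivity)] at h2
  rw [inner_sub_centeredOp] at h1 ⊢
  rw [div_mul_eq_mul_div, div_le_iff₀ (by positivity)]
  nlinarith [sq_nonneg ⟪Lp.const 2 μ (1 : ℝ), f⟫_ℝ,
    sq_nonneg ‖fstL2 Q μ f - sndL2 hQ.invariant f‖,
    mul_nonneg hC (sq_nonneg ⟪Lp.const 2 μ (1 : ℝ), f⟫_ℝ)]

end Reversible

/-! ### Propose-accept-reject kernels -/

section Accept

variable {S : Type*} [MeasureSpace S]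

theorem measurable_flux (π : Density S) (q : Proposal S) (α : Acceptance S) :
    Measurable fun z : S × S => ENNReal.ofReal (π z.1 * (q z.1 z.2 * α z.1 z.2)) :=
  ((π.measurable.comp measurable_fst).mul (q.measurable.mul α.measurable)).ennreal_ofReal

theorem measurable_accept (q : Proposal S) (α : Acceptance S) (x : S) :
    Measurable fun y => ENNReal.ofReal (q x y * α x y) :=
  ((q.measurable.mul α.measurable).comp measurable_prodMk_left).ennreal_ofReal

/-- Detailed balance of the accepted moves makes the kernel reversible. -/
theorem isReversible_kernel [SFinite (volume : Measure S)] {π : Density S} {q : Proposal S}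
    {α : Acceptance S}
    (h : ∀ x y, π x * (q x y * α x y) = π y * (q y x * α y x)) :
    Kernel.IsReversible (kernel q α) π.toMeasure := by
  intro A B hA hB
  -- The rejection part only sees `A ∩ B`, so it is symmetric in `A` and `B` for any acceptance
  -- rule; detailed balance is needed for the accepted flux alone.
  have key : ∀ {A B : Set S}, MeasurableSet A → MeasurableSet B →
      ∫⁻ x in A, kernel q α x B ∂π.toMeasure =
      (∫⁻ x in A, ∫⁻ y in B, ENNReal.ofReal (π x * (q x y * α x y))) +
        ∫⁻ x in A ∩ B, ENNReal.ofReal (1 - ∫ y, q x y * α x y) ∂π.toMeasure := by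
    intro A B hA hB
    have e : ∀ x, kernel q α x B = (∫⁻ y in B, ENNReal.ofReal (q x y * α x y)) +
        B.indicator (fun x => ENNReal.ofReal (1 - ∫ y, q x y * α x y)) x := by
      intro x
      change ((volume : Measure S).withDensity (fun y => ENNReal.ofReal (q x y * α x y))
        + ENNReal.ofReal (1 - ∫ y, q x y * α x y) • Measure.dirac x) B = _
      rw [Measure.add_apply, Measure.smul_apply, withDensity_apply _ hB,
        Measure.dirac_apply' _ hB, smul_eq_mul]
      by_cases hx : x ∈ B <;> simp [hx]
    have hm : Measurable fun x => ∫⁻ y in B, ENNReal.ofReal (q x y * α x y) :=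
      (q.measurable.mul α.measurable).ennreal_ofReal.lintegral_prod_right'
    simp_rw [e]
    rw [lintegral_add_left hm, lintegral_indicator hB, Measure.restrict_restrict hB,
      Set.inter_comm B A, Density.toMeasure, restrict_withDensity hA,
      lintegral_withDensity_eq_lintegral_mul _ π.measurable.ennreal_ofReal hm]
    congr 1
    refine lintegral_congr fun x => ?_
    rw [Pi.mul_apply, ← lintegral_const_mul _ (measurable_accept q α x)]
    refine lintegral_congr fun y => ?_
    rw [ENNReal.ofReal_mul (π.nonneg x)]
  rw [key hA hB, key hB hA, Set.inter_comm B A,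
    lintegral_lintegral_swap (measurable_flux π q α).aemeasurable]
  simp_rw [h]

/-- The rejection atom sits on the diagonal, where `F` vanishes. -/
theorem lintegral_compProd_kernel [SFinite (volume : Measure S)] (π : Density S)
    (q : Proposal S) (α : Acceptance S)
    [IsProbabilityMeasure π.toMeasure] {F : S × S → ℝ≥0∞} (hF : Measurable F)
    (hF0 : ∀ x, F (x, x) = 0) :
    ∫⁻ z, F z ∂(π.toMeasure ⊗ₘ kernel q α) =
      ∫⁻ x, ∫⁻ y, ENNReal.ofReal (π x * (q x y * α x y)) * F (x, y) := by
  have e : ∀ x, ∫⁻ y, F (x, y) ∂(kernel q α x) =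
      ∫⁻ y, ENNReal.ofReal (q x y * α x y) * F (x, y) := by
    intro x
    have hx : Measurable fun y => F (x, y) := hF.comp measurable_prodMk_left
    change ∫⁻ y, F (x, y) ∂((volume : Measure S).withDensity
      (fun y => ENNReal.ofReal (q x y * α x y))
        + ENNReal.ofReal (1 - ∫ y, q x y * α x y) • Measure.dirac x) = _
    rw [lintegral_add_measure, lintegral_smul_measure, lintegral_dirac' _ hx, hF0, smul_zero,
      add_zero, lintegral_withDensity_eq_lintegral_mul _ (measurable_accept q α x) hx]
    rfl
  have hm : Measurable fun x => ∫⁻ y, ENNReal.ofReal (q x y * α x y) * F (x, y) :=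
    ((q.measurable.mul α.measurable).ennreal_ofReal.mul hF).lintegral_prod_right'
  rw [Measure.lintegral_compProd hF]
  simp_rw [e]
  rw [Density.toMeasure, lintegral_withDensity_eq_lintegral_mul _ π.measurable.ennreal_ofReal hm]
  refine lintegral_congr fun x => ?_
  rw [Pi.mul_apply, ← lintegral_const_mul' _ _ ENNReal.ofReal_ne_top]
  refine lintegral_congr fun y => ?_
  rw [ENNReal.ofReal_mul (π.nonneg x), mul_assoc]

/-- Variance bounding is inherited by propose-accept-reject kernels that accept at least a fixed
fraction of the moves. -/
theorem VarianceBounding.of_accept_le [SFinite (volume : Measure S)] {π : Density S}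
    {q : Proposal S} {α β : Acceptance S}
    [IsProbabilityMeasure π.toMeasure]
    (hα : ∀ x y, π x * (q x y * α x y) = π y * (q y x * α y x))
    (hβ : ∀ x y, π x * (q x y * β x y) = π y * (q y x * β y x)) {C : ℝ} (hC : 0 ≤ C)
    (hle : ∀ x y, π x * (q x y * α x y) ≤ C * (π x * (q x y * β x y)))
    (h : VarianceBounding (kernel q α) π.toMeasure) :
    VarianceBounding (kernel q β) π.toMeasure := by
  refine h.of_dirichletForm_le (isReversible_kernel hα) (isReversible_kernel hβ) hC
    fun f hf => ?_
  have hF : Measurable fun z : S × S => ENNReal.ofReal ((f z.1 - f z.2) ^ 2) :=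
    (((hf.comp measurable_fst).sub (hf.comp measurable_snd)).pow_const 2).ennreal_ofReal
  rw [lintegral_compProd_kernel π q α hF (by simp), lintegral_compProd_kernel π q β hF (by simp),
    ← lintegral_const_mul' _ _ ENNReal.ofReal_ne_top]
  refine lintegral_mono fun x => ?_
  rw [← lintegral_const_mul' _ _ ENNReal.ofReal_ne_top]
  refine lintegral_mono fun y => ?_
  rw [← mul_assoc (ENNReal.ofReal C), ← ENNReal.ofReal_mul hC]
  exact mul_le_mul_left (ENNReal.ofReal_le_ofReal (hle x y)) _

/-! ### Metropolis-Hastings and delayed acceptance -/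

/-- At `a = 0` both sides vanish because `b ≥ 0`, so the convention for a zero denominator plays no
role in the flux. -/
theorem mul_min_one_div {a b : ℝ} (ha : 0 ≤ a) (hb : 0 ≤ b) : a * min 1 (b / a) = min a b := by
  rcases ha.eq_or_lt with rfl | ha
  · simp [hb]
  · rw [mul_min_of_nonneg _ _ ha.le, mul_one, mul_div_cancel₀ _ ha.ne']

theorem flux_acceptMH (π : Density S) (q : Proposal S) (x y : S) :
    π x * (q x y * acceptMH π q x y) = min (π x * q x y) (π y * q y x) := by
  rw [← mul_assoc]
  exact mul_min_one_div (mul_nonneg (π.nonneg x) (q.nonneg x y))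
    (mul_nonneg (π.nonneg y) (q.nonneg y x))

/-- Writing `π x = πhat x * (π x / πhat x)` gives one factor to each stage, and each stage becomes a
minimum. The result is visibly symmetric, which is detailed balance. Where `π x = 0` both sides
vanish. -/
theorem flux_acceptDA {π πhat : Density S} (h : ∀ x, 0 < π x → 0 < πhat x) (q : Proposal S)
    (x y : S) :
    π x * (q x y * acceptDA π πhat q x y) =
      min (πhat x * q x y) (πhat y * q y x) * min (π x / πhat x) (π y / πhat y) := by
  rcases (π.nonneg x).eq_or_lt with hx | hx
  · simp [← hx, div_nonneg (π.nonneg y) (πhat.nonneg y)]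
  have e : π x = πhat x * (π x / πhat x) := (mul_div_cancel₀ _ (h x hx).ne').symm
  have h1 := mul_min_one_div (mul_nonneg (πhat.nonneg x) (q.nonneg x y))
    (mul_nonneg (πhat.nonneg y) (q.nonneg y x))
  have h2 := mul_min_one_div (div_nonneg (π.nonneg x) (πhat.nonneg x))
    (div_nonneg (π.nonneg y) (πhat.nonneg y))
  rw [← h1, ← h2]
  change π x * (q x y * (min 1 (ratioMH πhat q x y) * min 1 (ratioCorrection π πhat x y))) = _
  rw [ratioMH, ratioCorrection]
  nth_rewrite 1 [e]
  ring

/-- Replacing `π` by `πhat` in the minimum costs `1/a`, and the correction factor is at least `1/b`.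
If `π` vanishes at either point, no flux passes. -/
theorem flux_acceptMH_le {π πhat : Density S} {a b : ℝ} (ha : 0 < a)
    (h : ∀ x, 0 < π x → a ≤ πhat x / π x ∧ πhat x / π x ≤ b) (q : Proposal S) (x y : S) :
    π x * (q x y * acceptMH π q x y) ≤ b / a * (π x * (q x y * acceptDA π πhat q x y)) := by
  have hpos : ∀ x, 0 < π x → 0 < πhat x := fun x hx =>
    (div_pos_iff_of_pos_right hx).1 (ha.trans_le (h x hx).1)
  rw [flux_acceptMH, flux_acceptDA hpos]
  rcases (π.nonneg x).eq_or_lt with hx | hx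
  · rw [← hx]
    simp [mul_nonneg (π.nonneg y) (q.nonneg y x), div_nonneg (π.nonneg y) (πhat.nonneg y)]
  rcases (π.nonneg y).eq_or_lt with hy | hy
  · rw [← hy]
    simp [mul_nonneg (π.nonneg x) (q.nonneg x y), div_nonneg (π.nonneg x) (πhat.nonneg x)]
  have hb : 0 < b := ha.trans_le ((h x hx).1.trans (h x hx).2)
  have hlo : ∀ x, 0 < π x → a * π x ≤ πhat x := fun x hx => (le_div_iff₀ hx).1 (h x hx).1
  have hhi : ∀ x, 0 < π x → b⁻¹ ≤ π x / πhat x := fun x hx => by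
    rw [← inv_div (πhat x)]
    exact inv_anti₀ (div_pos (hpos x hx) hx) (h x hx).2
  have h1 : a * min (π x * q x y) (π y * q y x) ≤
      min (πhat x * q x y) (πhat y * q y x) := by
    rw [mul_min_of_nonneg _ _ ha.le, ← mul_assoc, ← mul_assoc]
    exact min_le_min (mul_le_mul_of_nonneg_right (hlo x hx) (q.nonneg x y))
      (mul_le_mul_of_nonneg_right (hlo y hy) (q.nonneg y x))
  have h2 : b⁻¹ ≤ min (π x / πhat x) (π y / πhat y) := le_min (hhi x hx) (hhi y hy)
  have h0 : 0 ≤ min (πhat x * q x y) (πhat y * q y x) :=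
    le_min (mul_nonneg (πhat.nonneg x) (q.nonneg x y)) (mul_nonneg (πhat.nonneg y) (q.nonneg y x))
  calc min (π x * q x y) (π y * q y x)
      = b / a * (a * min (π x * q x y) (π y * q y x) * b⁻¹) := by field_simp
    _ ≤ _ := by gcongr

theorem isProbabilityMeasure_toMeasure {π : Density S} (hπ : ∫ x, π x = 1) :
    IsProbabilityMeasure π.toMeasure := by
  have hi : Integrable (fun x => π x) := by
    by_contra h
    rw [integral_undef h] at hπ
    exact zero_ne_one hπ
  refine ⟨?_⟩
  rw [Density.toMeasure, withDensity_apply _ MeasurableSet.univ, Measure.restrict_univ,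
    ← ofReal_integral_eq_lintegral_ofReal hi (.of_forall π.nonneg), hπ, ENNReal.ofReal_one]

/-- Delayed acceptance inherits variance bounding from Metropolis-Hastings if the approximation of
the target is accurate up to constant factors. -/
theorem varianceBounding_kernelDA [SFinite (volume : Measure S)] {π πhat : Density S}
    {q : Proposal S} (hπ : ∫ x, π x = 1)
    {a b : ℝ} (ha : 0 < a) (h : ∀ x, 0 < π x → a ≤ πhat x / π x ∧ πhat x / π x ≤ b)
    (hMH : VarianceBounding (kernelMH π q) π.toMeasure) :
    VarianceBounding (kernelDA π πhat q) π.toMeasure := by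
  have := isProbabilityMeasure_toMeasure hπ
  have hpos : ∀ x, 0 < π x → 0 < πhat x := fun x hx =>
    (div_pos_iff_of_pos_right hx).1 (ha.trans_le (h x hx).1)
  -- `max b 0` makes the constant nonnegative without exhibiting a point where `π` is positive.
  refine VarianceBounding.of_accept_le (C := max b 0 / a) ?_ ?_ (by positivity) ?_ hMH
  · exact fun x y => by rw [flux_acceptMH, flux_acceptMH, min_comm]
  · exact fun x y => by
      rw [flux_acceptDA hpos, flux_acceptDA hpos, min_comm, min_comm (π x / πhat x)]
  · exact flux_acceptMH_le ha (fun x hx => ⟨(h x hx).1, (h x hx).2.trans (le_max_left _ _)⟩) q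

end Accept

end DelayedAcceptance

theorem corollary2 {d : ℕ} (X : Set (EuclideanSpace ℝ (Fin d)))
    (hX : NullMeasurableSet X volume)
    (π πhat : DelayedAcceptance.Density (DelayedAcceptance.StateSpace X))
    (hπ : ∫ x, π x = 1)
    (q : DelayedAcceptance.Proposal (DelayedAcceptance.StateSpace X))
    (hγ : ∃ γlo γhi : ℝ, 0 < γlo ∧
      ∀ x, 0 < π x → γlo ≤ πhat x / π x ∧ πhat x / π x ≤ γhi)
    (hMH : DelayedAcceptance.VarianceBounding
      (DelayedAcceptance.kernelMH π q) π.toMeasure) :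
    DelayedAcceptance.VarianceBounding
      (DelayedAcceptance.kernelDA π πhat q) π.toMeasure := by
  obtain ⟨a, b, ha, h⟩ := hγ
  exact DelayedAcceptance.varianceBounding_kernelDA hπ ha h hMH
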